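/- Let $\mathcal H$ be a separable complex Hilbert space. A bounded operator $A$ on $\mathcal H$ is a *partial isometry* if it is isometric on its *initial space* $(\ker A)^\perp$, and a *shift* if it is an isometry with $A^{*m}\to 0$ strongly as $m\to\infty$. Let $S=(S_1,\dots,S_n)$ be a doubly commuting $n$-tuple of shifts on $\mathcal H$, i.e. $S_iS_j=S_jS_i$ for all $i,j$ and $S_i^*S_j=S_jS_i^*$ for all $i\neq j$. Put $\mathcal W(S)=\bigcap_{k=1}^n\ker S_k^*$, and write $P_{\mathcal M}$ for the orthogonal projection of $\mathcal H$ onto a closed subspace $\mathcal M$. Call a bounded operator $W$ on $\mathcal H$ *$S$-analytic* if $S_kW=WS_k$ for all $k$. Let $T$ be an *$S$-Toeplitz* operator on $\mathcal H$, i.e. a bounded operator with $S_k^*TS_k=T$ for all $k$. Then the following are equivalent: (i) $T$ is a partial isometry; (ii) there exist partially isometric $S$-analytic operators $W_1,W_2$ on $\mathcal H$ with equal initial spaces (equivalently, $W_1^*W_1=W_2^*W_2$) such that $T=W_1W_2^*$, and such that for all $k\in\{1,\dots,n\}$ (a) $S_k^*W_1P_{\ker S_k^*}W_2^*S_k=0$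 and (b) $S_k^*W_1P_{\mathcal W(S)}W_2^*S_k=0$. Moreover, (a) and (b) hold for every $k$ and every pair $W_1,W_2$ of partially isometric $S$-analytic operators with equal initial spaces and $T=W_1W_2^*$. Finally, for any pair $W_1,W_2$ of partially isometric $S$-analytic operators with equal initial spaces (whether or not $T=W_1W_2^*$) and for each $k$, conditions (a) and (b) are equivalent. -/

import Mathlib

open Filter Topology
open ContinuousLinearMap (adjoint)

section STuple

variable {H : Type*} [NormedAddCommGroup H] [InnerProductSpace ℂ H] [CompleteSpace H]

/-- The kernel of a bounded operator, as a subspace of `H`. -/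
def opKer (A : H →L[ℂ] H) : Submodule ℂ H :=
  LinearMap.ker (A : H →ₗ[ℂ] H)

/-- The initial space of a bounded operator: the orthogonal complement of its kernel. -/
noncomputable def initialSpace (A : H →L[ℂ] H) : Submodule ℂ H :=
  (opKer A)ᗮ

/-- A partial isometry: isometric on the orthogonal complement of the kernel. -/
def IsPartialIsometry (A : H →L[ℂ] H) : Prop :=
  ∀ x ∈ initialSpace A, ‖A x‖ = ‖x‖

/-- A shift: an isometry whose adjoint powers tend to `0` in the strong operator topology. -/
structure IsShift (A : H →L[ℂ] H) : Prop where
  isometry : ∀ x, ‖A x‖ = ‖x‖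
  adjoint_pow_tendsto : ∀ x, Tendsto (fun m : ℕ => ((adjoint A) ^ m) x) atTop (𝓝 0)

/-- A doubly commuting `n`-tuple of shifts. -/
structure IsDoublyCommutingShifts {n : ℕ} (S : Fin n → H →L[ℂ] H) : Prop where
  isShift : ∀ i, IsShift (S i)
  comm : ∀ i j, S i * S j = S j * S i
  doubly_comm : ∀ i j, i ≠ j → adjoint (S i) * S j = S j * adjoint (S i)

/-- `S`-Toeplitz operators. -/
def IsSToeplitz {n : ℕ} (S : Fin n → H →L[ℂ] H) (T : H →L[ℂ] H) : Prop :=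
  ∀ k, adjoint (S k) * T * S k = T

/-- `S`-analytic operators. -/
def IsSAnalytic {n : ℕ} (S : Fin n → H →L[ℂ] H) (T : H →L[ℂ] H) : Prop :=
  ∀ k, S k * T = T * S k

/-- The wandering subspace: the joint kernel of the adjoints. -/
noncomputable def wandering {n : ℕ} (S : Fin n → H →L[ℂ] H) : Submodule ℂ H :=
  ⨅ k, opKer (adjoint (S k))

theorem isClosed_wandering {n : ℕ} (S : Fin n → H →L[ℂ] H) :
    IsClosed (wandering S : Set H) := by
  rw [wandering, Submodule.coe_iInf]
  exact isClosed_iInter fun k => (adjoint (S k)).isClosed_ker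

instance instCompleteOpKer (A : H →L[ℂ] H) : CompleteSpace (opKer A) :=
  A.isClosed_ker.completeSpace_coe

instance instCompleteWandering {n : ℕ} (S : Fin n → H →L[ℂ] H) : CompleteSpace (wandering S) :=
  (isClosed_wandering S).completeSpace_coe

/-- The operator `S_k* W₁ P_{ker S_k*} W₂* S_k`, where `P` is the orthogonal projection. -/
noncomputable def kerCompression {n : ℕ} (S : Fin n → H →L[ℂ] H) (W₁ W₂ : H →L[ℂ] H)
    (k : Fin n) : H →L[ℂ] H :=
  adjoint (S k) * W₁ * (opKer (adjoint (S k))).starProjection * adjoint W₂ * S k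

/-- The operator `S_k* W₁ P_{𝒲(S)} W₂* S_k`, where `P` is the orthogonal projection. -/
noncomputable def wanderingCompression {n : ℕ} (S : Fin n → H →L[ℂ] H) (W₁ W₂ : H →L[ℂ] H)
    (k : Fin n) : H →L[ℂ] H :=
  adjoint (S k) * W₁ * (wandering S).starProjection * adjoint W₂ * S k

/-- A pair of partially isometric `S`-analytic operators with the same initial space. -/
structure IsAnalyticPair {n : ℕ} (S : Fin n → H →L[ℂ] H) (W₁ W₂ : H →L[ℂ] H) : Prop where
  partialIsometry_left : IsPartialIsometry W₁
  partialIsometry_right : IsPartialIsometry W₂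
  analytic_left : IsSAnalytic S W₁
  analytic_right : IsSAnalytic S W₂
  initialSpace_eq : initialSpace W₁ = initialSpace W₂

end STuple

/-! ### Algebraic characterizations of partial isometries. -/

section PartialIsometry

variable {H : Type*} [NormedAddCommGroup H] [InnerProductSpace ℂ H] [CompleteSpace H]

/-! The substance is (i) ⇒ (ii). If `T` is a partially isometric Toeplitz operator and `x` is in its
initial space `M`, then `⟪T S_k x, S_k T x⟫ = ‖x‖²` while both vectors have norm at most `‖x‖`, so
they coincide. Applying this to `T` and to `T*` shows that `M` is invariant under every `S_k` and
that the restricted tuple is doubly commuting (`final_doubly_commuting`).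

A Beurling–Lax–Halmos theorem (`exists_analytic_mul_adjoint_eq_starProjection`) then gives a
partially isometric analytic `W` with `W W* = T* T`, and `T = (T W) W*` is the factorization. It
rests on the Wold decomposition of both tuples and on the inequality between their wandering
dimensions (`nonempty_embedding_wandering`).

Condition (a) says exactly that `W₁ W₂*` is Toeplitz (`kerCompression_eq`). It is linked to (b) by
enlarging the joint kernel one index at a time: each step replaces `X` by `X - S_j X S_j*`, which
vanishes only if `X` does (`eq_zero_of_conj_shift`). -/

omit [CompleteSpace H] in
theorem mem_opKer {A : H →L[ℂ] H} {x : H} : x ∈ opKer A ↔ A x = 0 := LinearMap.mem_ker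

theorem adjoint_mul (A B : H →L[ℂ] H) : adjoint (A * B) = adjoint B * adjoint A :=
  ContinuousLinearMap.adjoint_comp A B

theorem adjoint_mul_self_eq_one {A : H →L[ℂ] H} (hA : ∀ x, ‖A x‖ = ‖x‖) :
    adjoint A * A = 1 :=
  (ContinuousLinearMap.norm_map_iff_adjoint_comp_self A).1 hA

theorem opKer_adjoint_mul_self (A : H →L[ℂ] H) : opKer (adjoint A * A) = opKer A :=
  ContinuousLinearMap.ker_adjoint_comp_self A

/-- The quadratic forms of both sides agree, since `‖A x‖ = ‖A P x‖ = ‖P x‖`; over `ℂ` the quadratic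
form determines the operator. -/
theorem isPartialIsometry_iff_adjoint_mul_self {A : H →L[ℂ] H} :
    IsPartialIsometry A ↔ adjoint A * A = (opKer A)ᗮ.starProjection := by
  constructor
  · intro h
    set P := (opKer A)ᗮ.starProjection with hP
    have hPm : ∀ x, P x ∈ initialSpace A := fun x =>
      Submodule.starProjection_apply_mem (opKer A)ᗮ x
    have hAP : ∀ x, A (P x) = A x := fun x => by
      have h1 : x - P x ∈ opKer A := by
        have := Submodule.sub_starProjection_mem_orthogonal (K := (opKer A)ᗮ) x
        rwa [Submodule.orthogonal_orthogonal] at this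
      rw [mem_opKer, map_sub, sub_eq_zero] at h1
      exact h1.symm
    have key : ∀ x, inner ℂ ((adjoint A * A) x) x = inner ℂ (P x) x := fun x => by
      rw [mul_apply_eq_comp, ContinuousLinearMap.adjoint_inner_left,
        inner_self_eq_norm_sq_to_K, ← hAP x, h (P x) (hPm x),
        ← inner_self_eq_norm_sq_to_K, hP, Submodule.inner_starProjection_left_eq_right,
        ← mul_apply_eq_comp (Submodule.starProjection _),
        (Submodule.isIdempotentElem_starProjection _).eq,
        ← Submodule.inner_starProjection_left_eq_right]
    have := (ext_inner_map ((adjoint A * A : H →L[ℂ] H) : H →ₗ[ℂ] H) (P : H →ₗ[ℂ] H)).1 key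
    exact ContinuousLinearMap.coe_injective this
  · intro h x hx
    have h1 : (adjoint A * A) x = x := by
      rw [h, Submodule.starProjection_eq_self_iff]; exact hx
    have h2 := ContinuousLinearMap.apply_norm_sq_eq_inner_adjoint_left A x
    change _ = RCLike.re (inner ℂ ((adjoint A * A) x) x) at h2
    rw [h1, inner_self_eq_norm_sq] at h2
    exact (sq_eq_sq₀ (norm_nonneg _) (norm_nonneg _)).1 h2

theorem isPartialIsometry_iff {A : H →L[ℂ] H} :
    IsPartialIsometry A ↔ A * adjoint A * A = A := by
  rw [isPartialIsometry_iff_adjoint_mul_self]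
  constructor
  · intro h
    rw [mul_assoc, h]
    ext x
    have h1 : x - (opKer A)ᗮ.starProjection x ∈ opKer A := by
      have := Submodule.sub_starProjection_mem_orthogonal (K := (opKer A)ᗮ) x
      rwa [Submodule.orthogonal_orthogonal] at this
    rw [mem_opKer, map_sub, sub_eq_zero] at h1
    exact h1.symm
  · intro h
    ext x
    -- `A* A x` is orthogonal to `ker A`, and `A A* A = A` puts `x - A* A x` in `ker A`.
    refine Submodule.eq_starProjection_of_mem_orthogonal ?_ ?_ |>.symm
    · rw [Submodule.mem_orthogonal]
      intro u hu
      rw [mul_apply_eq_comp, ContinuousLinearMap.adjoint_inner_right,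
        mem_opKer.1 hu, inner_zero_left]
    · rw [Submodule.orthogonal_orthogonal, mem_opKer, map_sub, sub_eq_zero]
      exact (DFunLike.congr_fun h x).symm

theorem isPartialIsometry_adjoint {A : H →L[ℂ] H} (h : IsPartialIsometry A) :
    IsPartialIsometry (adjoint A) := by
  rw [isPartialIsometry_iff] at h ⊢
  have := congrArg ContinuousLinearMap.adjoint h
  simpa only [adjoint_mul, ContinuousLinearMap.adjoint_adjoint, mul_assoc] using this

theorem IsPartialIsometry.norm_apply_le {A : H →L[ℂ] H} (h : IsPartialIsometry A) (x : H) :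
    ‖A x‖ ≤ ‖x‖ := by
  have h2 := ContinuousLinearMap.apply_norm_sq_eq_inner_adjoint_left A x
  change _ = RCLike.re (inner ℂ ((adjoint A * A) x) x) at h2
  rw [isPartialIsometry_iff_adjoint_mul_self.1 h,
    Submodule.re_inner_starProjection_eq_normSq] at h2
  have := Submodule.norm_starProjection_apply_le (opKer A)ᗮ x
  rw [(sq_eq_sq₀ (norm_nonneg _) (norm_nonneg _)).1 h2]
  exact this

theorem adjoint_mul_self_eq_of_initialSpace_eq {A B : H →L[ℂ] H} (hA : IsPartialIsometry A)
    (hB : IsPartialIsometry B) (h : initialSpace A = initialSpace B) :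
    adjoint A * A = adjoint B * B := by
  rw [isPartialIsometry_iff_adjoint_mul_self.1 hA, isPartialIsometry_iff_adjoint_mul_self.1 hB]
  unfold initialSpace at h
  simp only [h]

theorem initialSpace_eq_of_adjoint_mul_self_eq {A B : H →L[ℂ] H}
    (h : adjoint A * A = adjoint B * B) : initialSpace A = initialSpace B := by
  rw [initialSpace, initialSpace, ← opKer_adjoint_mul_self A, h, opKer_adjoint_mul_self]

/-- The product `W₁ W₂*` of partial isometries with equal initial spaces. -/
theorem IsPartialIsometry.mul_adjoint {A B : H →L[ℂ] H} (hA : IsPartialIsometry A)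
    (hB : IsPartialIsometry B) (h : initialSpace A = initialSpace B) :
    IsPartialIsometry (A * adjoint B) := by
  have e := adjoint_mul_self_eq_of_initialSpace_eq hA hB h
  rw [isPartialIsometry_iff] at *
  rw [adjoint_mul, ContinuousLinearMap.adjoint_adjoint]
  calc A * adjoint B * (B * adjoint A) * (A * adjoint B)
      = A * (adjoint B * B) * (adjoint A * A) * adjoint B := by simp only [mul_assoc]
    _ = A * adjoint A * A * adjoint A * A * adjoint B := by rw [← e]; simp only [mul_assoc]
    _ = A * adjoint B := by rw [hA, hA]

end PartialIsometry

/-! ### Partially isometric Toeplitz operators and their initial and final spaces. -/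

section Toeplitz

variable {H : Type*} [NormedAddCommGroup H] [InnerProductSpace ℂ H] [CompleteSpace H]

/-- A partially isometric Toeplitz operator intertwines the isometry on its initial space. -/
theorem IsPartialIsometry.intertwine {T S : H →L[ℂ] H} (hT : IsPartialIsometry T)
    (hS : ∀ x, ‖S x‖ = ‖x‖) (h : adjoint S * T * S = T) :
    T * S * (adjoint T * T) = S * T := by
  have key : ∀ x ∈ initialSpace T, T (S x) = S (T x) := fun x hx => by
    have h1 : RCLike.re (inner ℂ (T (S x)) (S (T x))) = ‖T x‖ ^ 2 := by
      rw [← ContinuousLinearMap.adjoint_inner_left]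
      have := DFunLike.congr_fun h x
      rw [mul_apply_eq_comp, mul_apply_eq_comp] at this
      rw [this, inner_self_eq_norm_sq]
    have h2 := norm_sub_sq (𝕜 := ℂ) (T (S x)) (S (T x))
    rw [h1, hS, hT x hx] at h2
    have h3 := hT.norm_apply_le (S x)
    rw [hS] at h3
    -- Equality case of Cauchy–Schwarz: the square is `‖T S x‖² - 2‖x‖² + ‖x‖²`, and `‖T S x‖ ≤
    -- ‖x‖`.
    have h4 : ‖T (S x) - S (T x)‖ ^ 2 ≤ 0 := by
      rw [h2]; nlinarith [norm_nonneg (T (S x)), norm_nonneg x]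
    have h5 : ‖T (S x) - S (T x)‖ = 0 := by
      nlinarith [norm_nonneg (T (S x) - S (T x))]
    rwa [norm_eq_zero, sub_eq_zero] at h5
  have hP := isPartialIsometry_iff_adjoint_mul_self.1 hT
  calc T * S * (adjoint T * T)
      = S * T * (adjoint T * T) := by
        rw [hP]
        ext x
        exact key _ (Submodule.starProjection_apply_mem (opKer T)ᗮ x)
    _ = S * (T * adjoint T * T) := by simp only [mul_assoc]
    _ = S * T := by rw [isPartialIsometry_iff.1 hT]

theorem isSToeplitz_adjoint {n : ℕ} {S : Fin n → H →L[ℂ] H} {T : H →L[ℂ] H}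
    (h : IsSToeplitz S T) : IsSToeplitz S (adjoint T) := fun k => by
  have := congrArg ContinuousLinearMap.adjoint (h k)
  simpa only [adjoint_mul, ContinuousLinearMap.adjoint_adjoint, mul_assoc] using this

/-- The initial projection of a partially isometric Toeplitz operator compresses the tuple to its
range, which is invariant. -/
theorem IsPartialIsometry.initial_invariant {T S : H →L[ℂ] H} (hT : IsPartialIsometry T)
    (hS : ∀ x, ‖S x‖ = ‖x‖)
    (h : adjoint S * adjoint T * S = adjoint T) :
    adjoint T * S * T = S * (adjoint T * T) := by
  have h2 := (isPartialIsometry_adjoint hT).intertwine hS h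
  rw [ContinuousLinearMap.adjoint_adjoint] at h2
  calc adjoint T * S * T
      = adjoint T * S * (T * adjoint T * T) := by
        rw [isPartialIsometry_iff.1 hT]
    _ = (adjoint T * S * (T * adjoint T)) * T := by
        simp only [mul_assoc]
    _ = S * (adjoint T * T) := by rw [h2, mul_assoc]

/-- The final space of a partially isometric Toeplitz operator is a doubly commuting
invariant subspace. -/
theorem final_doubly_commuting {T A B : H →L[ℂ] H} (hT : IsPartialIsometry T)
    (hB : ∀ x, ‖B x‖ = ‖x‖) (hA : ∀ x, ‖A x‖ = ‖x‖)
    (hTA : adjoint A * T * A = T)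
    (hTB : adjoint B * T * B = T)
    (hTB' : adjoint B * adjoint T * B = adjoint T)
    (hAB : adjoint A * B = B * adjoint A) :
    T * adjoint T * adjoint A * B * (T * adjoint T) = B * (T * adjoint T) * adjoint A := by
  set Q := T * adjoint T with hQ
  have hQs : adjoint Q = Q := by
    rw [hQ, adjoint_mul, ContinuousLinearMap.adjoint_adjoint]
  have hQT : Q * T = T := isPartialIsometry_iff.1 hT
  have hQQ : Q * Q = Q := by rw [hQ, ← mul_assoc, ← hQ, hQT]
  have b1 : adjoint T * B * Q = B * adjoint T := by
    simpa only [ContinuousLinearMap.adjoint_adjoint] using (isPartialIsometry_adjoint hT).intertwine hB hTB'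
  have a1 : T * A * adjoint T = A * Q := by
    have := (isPartialIsometry_adjoint hT).initial_invariant (S := A) hA
      (by rwa [ContinuousLinearMap.adjoint_adjoint])
    simpa only [ContinuousLinearMap.adjoint_adjoint] using this
  have b2 : T * B * adjoint T = B * Q := by
    have := (isPartialIsometry_adjoint hT).initial_invariant (S := B) hB
      (by rwa [ContinuousLinearMap.adjoint_adjoint])
    simpa only [ContinuousLinearMap.adjoint_adjoint] using this
  have a2 : T * adjoint A * adjoint T = Q * adjoint A := by
    have := congrArg adjoint a1
    simpa only [adjoint_mul, ContinuousLinearMap.adjoint_adjoint, hQs, ← mul_assoc] using this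
  have hX : T * adjoint A * B * adjoint T = Q * adjoint A * B * Q := by
    calc T * adjoint A * B * adjoint T = T * adjoint A * (adjoint T * B * Q) := by
          rw [b1, mul_assoc]
      _ = (T * adjoint A * adjoint T) * B * Q := by simp only [mul_assoc]
      _ = _ := by rw [a2]
  have hBB := adjoint_mul_self_eq_one hB
  have hBX : adjoint B * (Q * adjoint A * B * Q) = Q * adjoint A := by
    calc adjoint B * (Q * adjoint A * B * Q)
        = adjoint B * (T * (adjoint A * B) * adjoint T) := by rw [← hX]; simp only [mul_assoc]
      _ = (adjoint B * T * B) * adjoint A * adjoint T := by rw [hAB]; simp only [mul_assoc]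
      _ = Q * adjoint A := by rw [hTB, a2]
  have hQBQ : Q * (B * Q) = B * Q := by
    rw [← b2, ← mul_assoc, ← mul_assoc, hQT]
  -- The defect `Y` satisfies `B* Y = 0` and `Q Y = Y`, yet factors as `Q B Z`. Hence `Y* Y = Z* B*
  -- Q Y = Z* B* Y = 0`.
  set Y := Q * adjoint A * B * Q - B * Q * adjoint A with hY
  have hBY : adjoint B * Y = 0 := by
    rw [hY, mul_sub, hBX, mul_assoc B, ← mul_assoc, hBB, one_mul, sub_self]
  have hQY : Q * Y = Y := by
    rw [hY, mul_sub]
    congr 1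
    · simp only [← mul_assoc, hQQ]
    · rw [← mul_assoc, hQBQ]
  have hYf : Y = Q * B * (adjoint A * Q - Q * adjoint A) := by
    rw [hY, mul_sub]
    congr 1
    · rw [mul_assoc Q, hAB]; simp only [mul_assoc]
    · rw [show Q * B * (Q * adjoint A) = Q * (B * Q) * adjoint A by simp only [mul_assoc], hQBQ]
  have hYY : adjoint Y * Y = 0 := by
    have h1 : adjoint Y = adjoint (adjoint A * Q - Q * adjoint A) * (adjoint B * Q) := by
      conv_lhs => rw [hYf]
      rw [adjoint_mul, adjoint_mul, hQs]
    rw [h1, mul_assoc, mul_assoc (adjoint B), hQY, hBY, mul_zero]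
  have hY0 : Y = 0 := (ContinuousLinearMap.adjoint_comp_self_eq_zero_iff).1 hYY
  rwa [hY, sub_eq_zero] at hY0

end Toeplitz

/-! ### Reducing subspaces and operators fixed by conjugation with a shift. -/

section Projections

variable {H : Type*} [NormedAddCommGroup H] [InnerProductSpace ℂ H] [CompleteSpace H]

theorem starProjection_comm_of_reducing {K : Submodule ℂ H} [K.HasOrthogonalProjection]
    {A : H →L[ℂ] H} (hA : ∀ x ∈ K, A x ∈ K) (hA' : ∀ x ∈ K, adjoint A x ∈ K) (x : H) :
    K.starProjection (A x) = A (K.starProjection x) := by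
  refine Submodule.eq_starProjection_of_mem_orthogonal
    (hA _ (Submodule.starProjection_apply_mem _ _)) ?_
  rw [← map_sub, Submodule.mem_orthogonal]
  intro u hu
  rw [← ContinuousLinearMap.adjoint_inner_left]
  exact (Submodule.mem_orthogonal _ _).1 (Submodule.sub_starProjection_mem_orthogonal x) _
    (hA' u hu)

/-- Iterating gives `X = S^m X S*^m`, so `‖X x‖ = ‖X S*^m x‖` for every `m`, and the right side
tends to `0`. -/
theorem eq_zero_of_conj_shift {S X : H →L[ℂ] H} (hS : IsShift S) (h : X = S * X * adjoint S) :
    X = 0 := by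
  have hm : ∀ m : ℕ, X = S ^ m * X * adjoint S ^ m := fun m => by
    induction m with
    | zero => simp
    | succ m ih =>
      calc X = S ^ m * (S * X * adjoint S) * adjoint S ^ m := by rw [← h, ← ih]
        _ = S ^ (m + 1) * X * adjoint S ^ (m + 1) := by
          rw [pow_succ S, pow_succ' (adjoint S)]; simp only [mul_assoc]
  have hpow : ∀ (m : ℕ) (x : H), ‖(S ^ m) x‖ = ‖x‖ := fun m => by
    induction m with
    | zero => simp
    | succ m ih => intro x; rw [pow_succ, mul_apply_eq_comp, ih, hS.isometry]
  ext x
  have h0 : Tendsto (fun m : ℕ => X ((adjoint S ^ m) x)) atTop (𝓝 0) := by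
    have := (X.continuous.tendsto 0).comp (hS.adjoint_pow_tendsto x)
    rwa [map_zero] at this
  have h1 : (fun m : ℕ => ‖X ((adjoint S ^ m) x)‖) = fun _ => ‖X x‖ := by
    funext m
    conv_rhs => rw [hm m]
    rw [mul_apply_eq_comp, mul_apply_eq_comp, hpow]
  have h2 := h0.norm
  rw [h1, norm_zero] at h2
  simpa using tendsto_nhds_unique tendsto_const_nhds h2

end Projections

/-! ### Joint kernels and the equivalence of (a) and (b). -/

section JointKernel

variable {H : Type*} [NormedAddCommGroup H] [InnerProductSpace ℂ H] [CompleteSpace H]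
  {n : ℕ} {S : Fin n → H →L[ℂ] H}

/-- The joint kernel of the adjoints of the operators with index in `s`. -/
noncomputable def jointKer (S : Fin n → H →L[ℂ] H) (s : Finset (Fin n)) : Submodule ℂ H :=
  ⨅ k ∈ s, opKer (adjoint (S k))

theorem mem_jointKer {s : Finset (Fin n)} {x : H} :
    x ∈ jointKer S s ↔ ∀ k ∈ s, adjoint (S k) x = 0 := by
  simp only [jointKer, Submodule.mem_iInf, mem_opKer]

theorem mem_wandering {x : H} : x ∈ wandering S ↔ ∀ k, adjoint (S k) x = 0 := by
  simp only [wandering, Submodule.mem_iInf, mem_opKer]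

instance instCompleteJointKer (s : Finset (Fin n)) : CompleteSpace (jointKer S s) := by
  have : IsClosed (jointKer S s : Set H) := by
    simp only [jointKer, Submodule.coe_iInf]
    exact isClosed_iInter fun k => isClosed_iInter fun _ => (adjoint (S k)).isClosed_ker
  exact this.completeSpace_coe

namespace IsDoublyCommutingShifts

variable (hS : IsDoublyCommutingShifts S)
include hS

theorem adjoint_apply_self (k : Fin n) (x : H) : adjoint (S k) (S k x) = x :=
  DFunLike.congr_fun (adjoint_mul_self_eq_one (hS.isShift k).isometry) x

theorem adjoint_comm (i j : Fin n) :
    adjoint (S i) * adjoint (S j) = adjoint (S j) * adjoint (S i) := by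
  rw [← adjoint_mul, ← adjoint_mul, hS.comm]

/-- Double commutation makes `jointKer S s` reducing for `S j`, so its projection commutes with `1 -
S_j S_j*`, the projection onto `ker S_j*`. -/
theorem starProjection_jointKer_insert {j : Fin n} {s : Finset (Fin n)} (hj : j ∉ s) :
    (jointKer S (insert j s)).starProjection =
      (jointKer S s).starProjection -
        S j * (jointKer S s).starProjection * adjoint (S j) := by
  have h1 : ∀ x ∈ jointKer S s, S j x ∈ jointKer S s := fun x hx => by
    rw [mem_jointKer] at hx ⊢
    intro k hk
    have := DFunLike.congr_fun (hS.doubly_comm k j (by rintro rfl; exact hj hk)) x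
    simp only [mul_apply_eq_comp] at this
    rw [this, hx k hk, map_zero]
  have h2 : ∀ x ∈ jointKer S s, adjoint (S j) x ∈ jointKer S s := fun x hx => by
    rw [mem_jointKer] at hx ⊢
    intro k hk
    have := DFunLike.congr_fun (hS.adjoint_comm k j) x
    simp only [mul_apply_eq_comp] at this
    rw [this, hx k hk, map_zero]
  have hc : ∀ x, (jointKer S s).starProjection (adjoint (S j) x) =
      adjoint (S j) ((jointKer S s).starProjection x) :=
    starProjection_comm_of_reducing h2 (by rwa [ContinuousLinearMap.adjoint_adjoint])
  ext x
  simp only [sub_apply, mul_apply_eq_comp]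
  refine Submodule.eq_starProjection_of_mem_orthogonal ?_ ?_
  · rw [mem_jointKer]
    intro k hk
    rcases Finset.mem_insert.1 hk with rfl | hk
    · rw [map_sub, hS.adjoint_apply_self, hc, sub_self]
    · exact mem_jointKer.1 (Submodule.sub_mem _ (Submodule.starProjection_apply_mem _ _)
        (h1 _ (Submodule.starProjection_apply_mem _ _))) k hk
  · rw [Submodule.mem_orthogonal]
    intro u hu
    rw [mem_jointKer] at hu
    have hu' : u ∈ jointKer S s := mem_jointKer.2 fun k hk => hu k (Finset.mem_insert_of_mem hk)
    rw [sub_sub_eq_add_sub, add_sub_right_comm, inner_add_right,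
      (Submodule.mem_orthogonal _ _).1 (Submodule.sub_starProjection_mem_orthogonal x) u hu',
      ← ContinuousLinearMap.adjoint_inner_left, hu j (Finset.mem_insert_self _ _),
      inner_zero_left, add_zero]

/-- As `j ≠ k`, the outer factors `S_j` and `S_j*` pass through `S_k*`, `W₁`, `W₂*` and `S_k`. -/
theorem compression_insert {W₁ W₂ : H →L[ℂ] H} (h₁ : IsSAnalytic S W₁) (h₂ : IsSAnalytic S W₂)
    {j k : Fin n} (hjk : j ≠ k) {t : Finset (Fin n)} (hj : j ∉ t) :
    adjoint (S k) * W₁ * (jointKer S (insert j t)).starProjection * adjoint W₂ * S k =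
      adjoint (S k) * W₁ * (jointKer S t).starProjection * adjoint W₂ * S k -
        S j * (adjoint (S k) * W₁ * (jointKer S t).starProjection * adjoint W₂ * S k) *
          adjoint (S j) := by
  have h₂' : adjoint W₂ * adjoint (S j) = adjoint (S j) * adjoint W₂ := by
    rw [← adjoint_mul, ← adjoint_mul, h₂]
  rw [hS.starProjection_jointKer_insert hj, mul_sub, sub_mul, sub_mul]
  congr 1
  calc adjoint (S k) * W₁ * (S j * (jointKer S t).starProjection * adjoint (S j)) *
        adjoint W₂ * S k
      = adjoint (S k) * (W₁ * S j) * (jointKer S t).starProjection *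
        (adjoint (S j) * adjoint W₂) * S k := by simp only [mul_assoc]
    _ = (adjoint (S k) * S j) * W₁ * (jointKer S t).starProjection * adjoint W₂ *
        (adjoint (S j) * S k) := by rw [← h₁, ← h₂']; simp only [mul_assoc]
    _ = _ := by
      rw [hS.doubly_comm k j hjk.symm, hS.doubly_comm j k hjk]; simp only [mul_assoc]

theorem kerCompression_eq_zero_iff {W₁ W₂ : H →L[ℂ] H} (h₁ : IsSAnalytic S W₁)
    (h₂ : IsSAnalytic S W₂) (k : Fin n) :
    kerCompression S W₁ W₂ k = 0 ↔ wanderingCompression S W₁ W₂ k = 0 := by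
  have key : ∀ s : Finset (Fin n), k ∉ s →
      (kerCompression S W₁ W₂ k = 0 ↔
        adjoint (S k) * W₁ * (jointKer S (insert k s)).starProjection * adjoint W₂ * S k = 0) := by
    intro s
    induction s using Finset.induction_on with
    | empty =>
      intro _
      have : jointKer S (insert k ∅) = opKer (adjoint (S k)) := by simp [jointKer]
      rw [kerCompression, Submodule.starProjection_inj.2 this]
    | insert j s hj ih =>
      intro hk
      rw [Finset.mem_insert, not_or] at hk
      rw [ih hk.2, Finset.insert_comm, hS.compression_insert h₁ h₂ (Ne.symm hk.1)
        (by rw [Finset.mem_insert, not_or]; exact ⟨Ne.symm hk.1, hj⟩)]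
      constructor
      · intro h; rw [h]; simp
      · intro h; exact eq_zero_of_conj_shift (hS.isShift j) (sub_eq_zero.1 h)
  have : jointKer S (insert k (Finset.univ.erase k)) = wandering S := by
    simp [jointKer, wandering, Finset.insert_erase]
  rw [key _ (Finset.notMem_erase k _), wanderingCompression, Submodule.starProjection_inj.2 this]

omit hS in
theorem _root_.starProjection_opKer_adjoint {A : H →L[ℂ] H} (hA : adjoint A * A = 1) :
    (opKer (adjoint A)).starProjection = 1 - A * adjoint A := by
  have h : ∀ x, adjoint A (A x) = x := DFunLike.congr_fun hA
  ext x
  simp only [sub_apply, mul_apply_eq_comp]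
  refine Submodule.eq_starProjection_of_mem_orthogonal ?_ ?_
  · rw [mem_opKer]; simp [h]
  · rw [Submodule.mem_orthogonal]
    intro u hu
    simp [← ContinuousLinearMap.adjoint_inner_left, mem_opKer.1 hu]

/-- With `P = 1 - S_k S_k*`, analyticity moves the inner `S_k` and `S_k*` outwards, where they
cancel against the outer factors. -/
theorem kerCompression_eq {W₁ W₂ : H →L[ℂ] H} (h₁ : IsSAnalytic S W₁) (h₂ : IsSAnalytic S W₂)
    (k : Fin n) :
    kerCompression S W₁ W₂ k =
      adjoint (S k) * (W₁ * adjoint W₂) * S k - W₁ * adjoint W₂ := by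
  have h2 : adjoint (S k) * adjoint W₂ = adjoint W₂ * adjoint (S k) := by
    rw [← adjoint_mul, ← adjoint_mul, h₂]
  have hk := adjoint_mul_self_eq_one (hS.isShift k).isometry
  rw [kerCompression, starProjection_opKer_adjoint hk, mul_sub, sub_mul, sub_mul]
  have h3 : adjoint (S k) * W₁ * (S k * adjoint (S k)) * adjoint W₂ * S k = W₁ * adjoint W₂ := by
    calc adjoint (S k) * W₁ * (S k * adjoint (S k)) * adjoint W₂ * S k
        = adjoint (S k) * (W₁ * S k) * (adjoint (S k) * adjoint W₂) * S k := by
          simp only [mul_assoc]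
      _ = (adjoint (S k) * S k) * W₁ * adjoint W₂ * (adjoint (S k) * S k) := by
          rw [h2, ← h₁ k]; simp only [mul_assoc]
      _ = _ := by rw [hk, one_mul, mul_one]
  rw [h3, mul_one]
  simp only [mul_assoc]

end IsDoublyCommutingShifts

end JointKernel

/-! ### Monomials in the shifts and the Wold decomposition. -/

section Monomials

theorem exists_eq_single_add {n : ℕ} {k : Fin n} {β : Fin n → ℕ} (h : β k ≠ 0) :
    ∃ γ : Fin n → ℕ, β = Pi.single k 1 + γ := by
  refine ⟨β - Pi.single k 1, funext fun j => ?_⟩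
  by_cases hj : j = k
  · subst hj; simp; omega
  · simp [hj]

variable {H : Type*} [NormedAddCommGroup H] [InnerProductSpace ℂ H] [CompleteSpace H]
  {n : ℕ} {S : Fin n → H →L[ℂ] H}

namespace IsDoublyCommutingShifts

variable (hS : IsDoublyCommutingShifts S)
include hS

theorem pairwise_commute_powersHom : Pairwise fun i j =>
    ∀ x y : Multiplicative ℕ, Commute (powersHom _ (S i) x) (powersHom _ (S j) y) :=
  fun i j _ x y => by
    simp only [powersHom_apply]
    exact (show Commute (S i) (S j) from hS.comm i j).pow_pow _ _

/-- The product of the powers `S k ^ β k`. -/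
noncomputable def monomial (β : Fin n → ℕ) : H →L[ℂ] H :=
  MonoidHom.noncommPiCoprod (fun k => powersHom (H →L[ℂ] H) (S k))
    hS.pairwise_commute_powersHom (fun k => Multiplicative.ofAdd (β k))

theorem monomial_zero : hS.monomial 0 = 1 :=
  map_one (MonoidHom.noncommPiCoprod _ hS.pairwise_commute_powersHom)

theorem monomial_add (β γ : Fin n → ℕ) :
    hS.monomial (β + γ) = hS.monomial β * hS.monomial γ :=
  map_mul (MonoidHom.noncommPiCoprod _ hS.pairwise_commute_powersHom) _ _

theorem monomial_single (k : Fin n) : hS.monomial (Pi.single k 1) = S k := by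
  have : (fun j => Multiplicative.ofAdd ((Pi.single k 1 : Fin n → ℕ) j)) =
      Pi.mulSingle k (Multiplicative.ofAdd 1) := by
    funext j
    by_cases h : j = k
    · subst h; simp
    · simp [h]
  rw [monomial, this, MonoidHom.noncommPiCoprod_mulSingle]
  simp [powersHom_apply]

theorem monomial_single_add (k : Fin n) (β : Fin n → ℕ) :
    hS.monomial (Pi.single k 1 + β) = S k * hS.monomial β := by
  rw [monomial_add, monomial_single]

theorem monomial_induction (p : (H →L[ℂ] H) → Prop) (hmul : ∀ A B, p A → p B → p (A * B))
    (hone : p 1) (β : Fin n → ℕ) (hp : ∀ k, p (S k ^ β k)) : p (hS.monomial β) := by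
  rw [monomial, MonoidHom.noncommPiCoprod_apply]
  refine Finset.noncommProd_induction _ _ _ p hmul hone fun k _ => ?_
  simpa [powersHom_apply] using hp k

theorem norm_monomial_apply (β : Fin n → ℕ) (x : H) : ‖hS.monomial β x‖ = ‖x‖ := by
  refine hS.monomial_induction (fun A => ∀ x, ‖A x‖ = ‖x‖)
    (fun A B hA hB x => by rw [mul_apply_eq_comp, hA, hB]) (fun x => rfl) β (fun k => ?_) x
  induction β k with
  | zero => intro x; simp
  | succ m ih => intro x; rw [pow_succ, mul_apply_eq_comp, ih, (hS.isShift k).isometry]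

theorem inner_monomial_monomial (β : Fin n → ℕ) (x y : H) :
    inner ℂ (hS.monomial β x) (hS.monomial β y) = inner ℂ x y :=
  ((LinearMap.norm_map_iff_inner_map_map (hS.monomial β)).1 (hS.norm_monomial_apply β)) x y

theorem adjoint_mul_monomial {k : Fin n} {β : Fin n → ℕ} (h : β k = 0) :
    adjoint (S k) * hS.monomial β = hS.monomial β * adjoint (S k) := by
  refine hS.monomial_induction (fun A => Commute (adjoint (S k)) A)
    (fun _ _ => Commute.mul_right) (Commute.one_right _) β fun j => ?_
  by_cases hj : k = j
  · subst hj; rw [h, pow_zero]; exact Commute.one_right _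
  · exact (show Commute (adjoint (S k)) (S j) from hS.doubly_comm k j hj).pow_right _

theorem adjoint_monomial_apply_eq_zero {k : Fin n} {β : Fin n → ℕ} (h : β k = 0) {x : H}
    (hx : x ∈ wandering S) : adjoint (S k) (hS.monomial β x) = 0 := by
  have := DFunLike.congr_fun (hS.adjoint_mul_monomial h) x
  rw [mul_apply_eq_comp, mul_apply_eq_comp, mem_wandering.1 hx k, map_zero] at this
  exact this

theorem inner_monomial_eq_zero {x y : H} (hx : x ∈ wandering S) (hy : y ∈ wandering S) :
    ∀ {α β : Fin n → ℕ}, α ≠ β → inner ℂ (hS.monomial α x) (hS.monomial β y) = 0 := by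
  -- In a coordinate where the exponents differ, cancel the smaller power of `S k`; a remaining `S
  -- k` on one side is then moved across as `S_k*`, which kills the other side.
  have main : ∀ (k : Fin n) (m : ℕ) (x y : H), x ∈ wandering S → y ∈ wandering S →
      ∀ α β : Fin n → ℕ, α k = m → m < β k →
      inner ℂ (hS.monomial α x) (hS.monomial β y) = 0 := by
    intro k m
    induction m with
    | zero =>
      intro x y hx _ α β hα hβ
      obtain ⟨γ, rfl⟩ := exists_eq_single_add (k := k) hβ.ne'
      rw [hS.monomial_single_add, mul_apply_eq_comp,
        ← ContinuousLinearMap.adjoint_inner_left, hS.adjoint_monomial_apply_eq_zero hα hx,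
        inner_zero_left]
    | succ m ih =>
      intro x y hx hy α β hα hβ
      obtain ⟨γ, rfl⟩ := exists_eq_single_add (k := k) (β := β) (by omega)
      obtain ⟨δ, rfl⟩ := exists_eq_single_add (k := k) (β := α) (by omega)
      rw [hS.monomial_single_add, hS.monomial_single_add, mul_apply_eq_comp, mul_apply_eq_comp,
        ← ContinuousLinearMap.adjoint_inner_left, hS.adjoint_apply_self]
      simp only [Pi.add_apply, Pi.single_eq_same] at hα hβ
      exact ih x y hx hy δ γ (by omega) (by omega)
  intro α β hne
  obtain ⟨k, hk⟩ := Function.ne_iff.1 hne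
  rcases lt_or_gt_of_ne hk with h | h
  · exact main k _ x y hx hy α β rfl h
  · rw [← inner_conj_symm, main k _ y x hy hx β α rfl h, map_zero]

theorem orthonormal_monomial {ι : Type*} {f : ι → H} (hf : Orthonormal ℂ f)
    (hw : ∀ i, f i ∈ wandering S) :
    Orthonormal ℂ fun p : (Fin n → ℕ) × ι => hS.monomial p.1 (f p.2) := by
  refine ⟨fun p => by rw [hS.norm_monomial_apply, hf.1], ?_⟩
  rintro ⟨α, i⟩ ⟨β, j⟩ hne
  change inner ℂ (hS.monomial α (f i)) (hS.monomial β (f j)) = 0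
  by_cases h : α = β
  · subst h
    rw [hS.inner_monomial_monomial]
    exact hf.2 fun hij => hne (by rw [hij])
  · exact hS.inner_monomial_eq_zero (hw i) (hw j) h

/-- A nonzero reducing subspace meets the wandering subspace. -/
theorem exists_mem_wandering {Z : Submodule ℂ H} (hZ : ∀ k, ∀ x ∈ Z, S k x ∈ Z)
    (hZ' : ∀ k, ∀ x ∈ Z, adjoint (S k) x ∈ Z) (hne : Z ≠ ⊥) :
    ∃ x ∈ Z, x ≠ 0 ∧ x ∈ wandering S := by
  have key : ∀ s : Finset (Fin n), ∃ x ∈ Z, x ≠ 0 ∧ ∀ k ∈ s, adjoint (S k) x = 0 := by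
    intro s
    induction s using Finset.induction_on with
    | empty =>
      obtain ⟨x, hx, h0⟩ := Submodule.exists_mem_ne_zero_of_ne_bot hne
      exact ⟨x, hx, h0, by simp⟩
    | insert k s hk ih =>
      obtain ⟨y, hy, hy0, hys⟩ := ih
      have hpow : ∀ m : ℕ, (adjoint (S k) ^ m) y ∈ Z ∧
          ∀ j ∈ s, adjoint (S j) ((adjoint (S k) ^ m) y) = 0 := fun m => by
        induction m with
        | zero => exact ⟨hy, hys⟩
        | succ m ih =>
          rw [pow_succ', mul_apply_eq_comp]
          refine ⟨hZ' k _ ih.1, fun j hj => ?_⟩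
          have := DFunLike.congr_fun (hS.adjoint_comm j k) ((adjoint (S k) ^ m) y)
          rw [mul_apply_eq_comp, mul_apply_eq_comp, ih.2 j hj, map_zero] at this
          exact this
      -- These vectors are `(1 - S_k S_k*) S_k*^m y`, which `S_k*` kills. Were they all zero,
      -- `‖S_k*^m y‖` would be constant in `m`, against the shift property.
      have hex : ∃ m : ℕ, (adjoint (S k) ^ m) y - S k ((adjoint (S k) ^ (m + 1)) y) ≠ 0 := by
        by_contra! hcon
        have hnorm : ∀ m : ℕ, ‖(adjoint (S k) ^ m) y‖ = ‖y‖ := fun m => by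
          induction m with
          | zero => simp
          | succ m ih => rw [← ih, ← (hS.isShift k).isometry, ← sub_eq_zero.1 (hcon m)]
        have h2 := ((hS.isShift k).adjoint_pow_tendsto y).norm
        simp only [hnorm, norm_zero] at h2
        exact hy0 (norm_eq_zero.1 (tendsto_nhds_unique tendsto_const_nhds h2))
      obtain ⟨m, hm⟩ := hex
      refine ⟨_, Z.sub_mem (hpow m).1 (hZ k _ (hpow (m + 1)).1), hm, fun j hj => ?_⟩
      rcases Finset.mem_insert.1 hj with rfl | hj'
      · rw [map_sub, hS.adjoint_apply_self, pow_succ', mul_apply_eq_comp, sub_self]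
      · have := DFunLike.congr_fun (hS.doubly_comm j k (by rintro rfl; exact hk hj'))
          ((adjoint (S k) ^ (m + 1)) y)
        rw [mul_apply_eq_comp, mul_apply_eq_comp, (hpow _).2 j hj', map_zero] at this
        rw [map_sub, (hpow m).2 j hj', this, sub_zero]
  obtain ⟨x, hx, h0, h⟩ := key Finset.univ
  exact ⟨x, hx, h0, mem_wandering.2 fun k => h k (Finset.mem_univ k)⟩

omit hS [CompleteSpace H] in
theorem _root_.mem_orthogonal_span_range {ι : Type*} {v : ι → H} {x : H} :
    x ∈ (Submodule.span ℂ (Set.range v))ᗮ ↔ ∀ i, inner ℂ (v i) x = 0 := by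
  rw [Submodule.mem_orthogonal]
  refine ⟨fun h i => h _ (Submodule.subset_span ⟨i, rfl⟩), fun h u hu => ?_⟩
  induction hu using Submodule.span_induction with
  | mem u hu => obtain ⟨i, rfl⟩ := hu; exact h i
  | zero => exact inner_zero_left _
  | add u v _ _ hu hv => rw [inner_add_left, hu, hv, add_zero]
  | smul a u _ hu => rw [inner_smul_left, hu, mul_zero]

/-- The complement is reducing, so if nonzero it contains a nonzero wandering vector; the monomials
of exponent `0` make that vector orthogonal to the basis `b`. -/
theorem orthogonal_span_monomial {ι : Type*} (b : HilbertBasis ι ℂ (wandering S)) :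
    (Submodule.span ℂ (Set.range
      fun p : (Fin n → ℕ) × ι => hS.monomial p.1 (b p.2 : H)))ᗮ = ⊥ := by
  by_contra hne
  have hinv : ∀ k, ∀ x ∈ (Submodule.span ℂ (Set.range
      fun p : (Fin n → ℕ) × ι => hS.monomial p.1 (b p.2 : H)))ᗮ, S k x ∈ (Submodule.span ℂ
      (Set.range fun p : (Fin n → ℕ) × ι => hS.monomial p.1 (b p.2 : H)))ᗮ := by
    intro k x hx
    rw [mem_orthogonal_span_range] at hx ⊢
    rintro ⟨β, i⟩
    rw [← ContinuousLinearMap.adjoint_inner_left]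
    by_cases h : β k = 0
    · rw [hS.adjoint_monomial_apply_eq_zero h (b i).2, inner_zero_left]
    · obtain ⟨γ, rfl⟩ := exists_eq_single_add h
      rw [hS.monomial_single_add, mul_apply_eq_comp, hS.adjoint_apply_self]
      exact hx (γ, i)
  obtain ⟨x, hx, hx0, hxw⟩ := hS.exists_mem_wandering hinv (fun k x hx => by
    rw [mem_orthogonal_span_range] at hx ⊢
    rintro ⟨β, i⟩
    rw [ContinuousLinearMap.adjoint_inner_right, ← mul_apply_eq_comp, ← hS.monomial_single_add]
    exact hx (_, i)) hne
  rw [mem_orthogonal_span_range] at hx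
  have h0 : (⟨x, hxw⟩ : wandering S) = 0 := by
    apply b.repr.injective
    ext i
    rw [b.repr_apply_apply, map_zero]
    have := hx (0, i)
    rwa [monomial_zero] at this
  exact hx0 (congrArg Subtype.val h0)

omit hS [CompleteSpace H] in
theorem _root_.orthonormal_coe {ι : Type*} {K : Submodule ℂ H} {f : ι → K}
    (hf : Orthonormal ℂ f) : Orthonormal ℂ fun i => (f i : H) :=
  hf.comp_linearIsometry K.subtypeₗᵢ

/-- The Wold decomposition: a Hilbert basis of the wandering subspace generates one of the
whole space. -/
noncomputable def hilbertBasis {ι : Type*} (b : HilbertBasis ι ℂ (wandering S)) :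
    HilbertBasis ((Fin n → ℕ) × ι) ℂ H :=
  HilbertBasis.mkOfOrthogonalEqBot
    (hS.orthonormal_monomial (orthonormal_coe b.orthonormal) fun i => (b i).2)
    (hS.orthogonal_span_monomial b)

theorem hilbertBasis_apply {ι : Type*} (b : HilbertBasis ι ℂ (wandering S))
    (p : (Fin n → ℕ) × ι) : hS.hilbertBasis b p = hS.monomial p.1 (b p.2 : H) := by
  rw [hilbertBasis, HilbertBasis.coe_mkOfOrthogonalEqBot]

end IsDoublyCommutingShifts

end Monomials

/-! ### Comparison of wandering dimensions. -/

section Dimension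

variable {H : Type*} [NormedAddCommGroup H] [InnerProductSpace ℂ H] [CompleteSpace H]
  {n : ℕ} {S : Fin n → H →L[ℂ] H}

omit [CompleteSpace H] in
theorem Orthonormal.countable_index [TopologicalSpace.SeparableSpace H] {ι : Type*} {v : ι → H}
    (hv : Orthonormal ℂ v) : Countable ι := by
  refine Pairwise.countable_of_isOpen_disjoint (s := fun i => Metric.ball (v i) (1 / 2)) ?_
    (fun i => Metric.isOpen_ball) (fun i => ⟨v i, Metric.mem_ball_self (by norm_num)⟩)
  intro i j hij
  -- Distinct orthonormal vectors are at distance `√2`, more than the sum of the radii.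
  refine Metric.ball_disjoint_ball ?_
  have h := norm_sub_sq (𝕜 := ℂ) (v i) (v j)
  rw [hv.2 hij, hv.1, hv.1, map_zero] at h
  rw [dist_eq_norm]
  nlinarith [norm_nonneg (v i - v j)]

namespace IsDoublyCommutingShifts

variable (hS : IsDoublyCommutingShifts S)
include hS

/-- Applying the isometry `S^(γ - β)` to both entries turns each term into a coefficient of the
single vector `S^γ e` along the orthonormal family, so Bessel's inequality applies. -/
theorem sum_norm_inner_sq_le {ι : Type*} {f : ι → H}
    (hf : Orthonormal ℂ fun p : (Fin n → ℕ) × ι => hS.monomial p.1 (f p.2))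
    (s : Finset ι) (γ : Fin n → ℕ) (e : H) :
    ∑ i ∈ s, ∑ β ∈ Finset.Iic γ, ‖inner ℂ (hS.monomial β e) (f i)‖ ^ 2 ≤ ‖e‖ ^ 2 := by
  have h1 : ∀ i, ∀ β ∈ Finset.Iic γ, ‖inner ℂ (hS.monomial β e) (f i)‖ ^ 2 =
      ‖inner ℂ (hS.monomial (γ - β) (f i)) (hS.monomial γ e)‖ ^ 2 := by
    intro i β hβ
    conv_rhs => rw [← tsub_add_cancel_of_le (Finset.mem_Iic.1 hβ)]
    rw [add_tsub_cancel_right, hS.monomial_add, mul_apply_eq_comp, hS.inner_monomial_monomial,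
      norm_inner_symm]
  have hinj : Set.InjOn (fun p : ι × (Fin n → ℕ) => ((γ - p.2, p.1) : (Fin n → ℕ) × ι))
      (s ×ˢ Finset.Iic γ : Finset (ι × (Fin n → ℕ))) := by
    rintro ⟨i, α⟩ hα ⟨j, β⟩ hβ hαβ
    simp only [Finset.coe_product, Set.mem_prod, Finset.mem_coe, Finset.mem_Iic] at hα hβ
    simp only [Prod.mk.injEq] at hαβ ⊢
    refine ⟨hαβ.2, ?_⟩
    rw [← tsub_tsub_cancel_of_le hα.2, hαβ.1, tsub_tsub_cancel_of_le hβ.2]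
  classical
  calc ∑ i ∈ s, ∑ β ∈ Finset.Iic γ, ‖inner ℂ (hS.monomial β e) (f i)‖ ^ 2
      = ∑ p ∈ s ×ˢ Finset.Iic γ,
          ‖inner ℂ (hS.monomial (γ - p.2) (f p.1)) (hS.monomial γ e)‖ ^ 2 := by
        rw [Finset.sum_product]
        exact Finset.sum_congr rfl fun i _ => Finset.sum_congr rfl (h1 i)
    _ = ∑ q ∈ (s ×ˢ Finset.Iic γ).image fun p => ((γ - p.2, p.1) : (Fin n → ℕ) × ι),
          ‖inner ℂ (hS.monomial q.1 (f q.2)) (hS.monomial γ e)‖ ^ 2 := by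
        rw [Finset.sum_image hinj]
    _ ≤ ‖hS.monomial γ e‖ ^ 2 := hf.sum_inner_products_le _
    _ = ‖e‖ ^ 2 := by rw [hS.norm_monomial_apply]

/-- The wandering dimension of a jointly invariant doubly commuting subspace is at most that of
the whole space. -/
theorem card_le_card_wandering {ι κ : Type*} [Fintype κ]
    (b : HilbertBasis κ ℂ (wandering S)) {f : ι → H}
    (hf : Orthonormal ℂ fun p : (Fin n → ℕ) × ι => hS.monomial p.1 (f p.2)) (s : Finset ι) :
    s.card ≤ Fintype.card κ := by
  set c := hS.hilbertBasis b with hc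
  have hnorm : ∀ i, ‖f i‖ = 1 := fun i => by
    rw [← hf.1 (0, i), hS.norm_monomial_apply]
  have hpars : ∀ i, HasSum (fun p => ‖inner ℂ (c p) (f i)‖ ^ 2) 1 := fun i => by
    have h := (c.hasSum_inner_mul_inner (f i) (f i)).mapL (RCLike.reCLM (K := ℂ))
    rw [RCLike.reCLM_apply, inner_self_eq_norm_sq, hnorm, one_pow] at h
    have he : ∀ p, RCLike.re (inner ℂ (f i) (c p) * inner ℂ (c p) (f i)) =
        ‖inner ℂ (c p) (f i)‖ ^ 2 := fun p => by
      rw [inner_mul_symm_re_eq_norm, norm_mul, norm_inner_symm, sq]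
    simpa only [RCLike.reCLM_apply, he] using h
  have hsum : HasSum (fun p => ∑ i ∈ s, ‖inner ℂ (c p) (f i)‖ ^ 2) (s.card : ℝ) := by
    have := hasSum_sum (s := s) fun i _ => hpars i
    simpa using this
  -- `s.card` is the sum of all Parseval coefficients of the `f i`; a finite part of it lies in a
  -- box `β ≤ γ`, where each basis vector of the wandering subspace contributes at most `1`.
  have hle : (s.card : ℝ) ≤ Fintype.card κ := by
    refine hasSum_le_of_sum_le hsum fun F => ?_
    obtain ⟨γ, hγ⟩ : ∃ γ : Fin n → ℕ, ∀ p ∈ F, p.1 ≤ γ :=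
      ⟨F.sup Prod.fst, fun p hp => Finset.le_sup (f := Prod.fst) hp⟩
    calc ∑ p ∈ F, ∑ i ∈ s, ‖inner ℂ (c p) (f i)‖ ^ 2
        ≤ ∑ p ∈ Finset.Iic γ ×ˢ Finset.univ, ∑ i ∈ s, ‖inner ℂ (c p) (f i)‖ ^ 2 := by
          refine Finset.sum_le_sum_of_subset_of_nonneg (fun p hp => ?_)
            fun p _ _ => Finset.sum_nonneg fun i _ => sq_nonneg _
          exact Finset.mem_product.2 ⟨Finset.mem_Iic.2 (hγ p hp), Finset.mem_univ _⟩
      _ = ∑ l : κ, ∑ i ∈ s, ∑ β ∈ Finset.Iic γ,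
            ‖inner ℂ (hS.monomial β (b l : H)) (f i)‖ ^ 2 := by
          rw [Finset.sum_product_right]
          refine Finset.sum_congr rfl fun l _ => ?_
          rw [Finset.sum_comm]
          simp only [hc, hilbertBasis_apply]
      _ ≤ ∑ l : κ, ‖(b l : H)‖ ^ 2 :=
          Finset.sum_le_sum fun l _ => hS.sum_norm_inner_sq_le hf s γ _
      _ = Fintype.card κ := by
          simp [(orthonormal_coe b.orthonormal).1]
  exact_mod_cast hle

theorem nonempty_embedding_wandering [TopologicalSpace.SeparableSpace H] {ι κ : Type*}
    (b : HilbertBasis κ ℂ (wandering S)) {f : ι → H}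
    (hf : Orthonormal ℂ fun p : (Fin n → ℕ) × ι => hS.monomial p.1 (f p.2)) :
    Nonempty (ι ↪ κ) := by
  -- Counting needs `κ` finite; for infinite `κ`, separability makes `ι` countable, which suffices.
  cases finite_or_infinite κ
  · have := Fintype.ofFinite κ
    have hcard := hS.card_le_card_wandering b hf
    have hι : Finite ι := by
      by_contra hinf
      rw [not_finite_iff_infinite] at hinf
      obtain ⟨s, hs⟩ := Infinite.exists_subset_card_eq ι (Fintype.card κ + 1)
      have := hcard s
      omega
    have := Fintype.ofFinite ι
    exact Function.Embedding.nonempty_of_card_le (hcard Finset.univ)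
  · have : Countable ι := by
      have hc := hf.countable_index
      exact Function.Injective.countable (f := fun i : ι => ((0, i) : (Fin n → ℕ) × ι))
        fun i j h => (Prod.mk.injEq _ _ _ _ ▸ h).2
    obtain ⟨g, hg⟩ := exists_injective_nat ι
    exact ⟨(⟨g, hg⟩ : ι ↪ ℕ).trans (Infinite.natEmbedding κ)⟩

end IsDoublyCommutingShifts

end Dimension

/-! ### Restriction to invariant subspaces and the Beurling–Lax–Halmos theorem. -/

section InvariantSubspace

variable {H : Type*} [NormedAddCommGroup H] [InnerProductSpace ℂ H] [CompleteSpace H]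
  {n : ℕ} {S : Fin n → H →L[ℂ] H} {M : Submodule ℂ H}

/-- The restriction of a bounded operator to an invariant subspace. -/
def restrictInvariant (A : H →L[ℂ] H) (hA : ∀ x ∈ M, A x ∈ M) : M →L[ℂ] M :=
  (A ∘L M.subtypeL).codRestrict M fun x => hA x x.2

omit [CompleteSpace H] in
theorem coe_restrictInvariant (A : H →L[ℂ] H) (hA : ∀ x ∈ M, A x ∈ M) (x : M) :
    (restrictInvariant A hA x : H) = A x := rfl

theorem coe_adjoint_restrictInvariant [CompleteSpace M] (A : H →L[ℂ] H)
    (hA : ∀ x ∈ M, A x ∈ M) (x : M) :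
    (adjoint (restrictInvariant A hA) x : H) = M.starProjection (adjoint A x) := by
  refine (Submodule.eq_starProjection_of_mem_of_inner_eq_zero (K := M) (Subtype.coe_prop _)
    fun w hw => ?_).symm
  rw [inner_sub_left, ContinuousLinearMap.adjoint_inner_left, sub_eq_zero]
  exact (ContinuousLinearMap.adjoint_inner_left (restrictInvariant A hA) ⟨w, hw⟩ x).symm

/-- The adjoint form of invariance, `P A* P = P A*`; it collapses powers of the compression `P A*`
to `P A*^m`. -/
theorem starProjection_adjoint_starProjection [CompleteSpace M] {A : H →L[ℂ] H}
    (hA : ∀ x ∈ M, A x ∈ M) (x : H) :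
    M.starProjection (adjoint A (M.starProjection x)) = M.starProjection (adjoint A x) := by
  refine ext_inner_right ℂ fun y => ?_
  rw [Submodule.inner_starProjection_left_eq_right, Submodule.inner_starProjection_left_eq_right,
    ContinuousLinearMap.adjoint_inner_left, ContinuousLinearMap.adjoint_inner_left,
    Submodule.inner_starProjection_left_eq_right,
    Submodule.starProjection_eq_self_iff.2 (hA _ (Submodule.starProjection_apply_mem _ _))]

theorem IsShift.restrictInvariant [CompleteSpace M] {A : H →L[ℂ] H} (hS : IsShift A)
    (hA : ∀ x ∈ M, A x ∈ M) : IsShift (restrictInvariant A hA) := by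
  refine ⟨fun x => hS.isometry x, fun x => ?_⟩
  have h1 : ∀ m : ℕ, (((ContinuousLinearMap.adjoint (_root_.restrictInvariant A hA)) ^ m) x : H) =
      M.starProjection ((ContinuousLinearMap.adjoint A ^ m) x) := fun m => by
    induction m with
    | zero => simp
    | succ m ih =>
      rw [pow_succ', mul_apply_eq_comp, coe_adjoint_restrictInvariant, ih,
        starProjection_adjoint_starProjection hA, pow_succ', mul_apply_eq_comp]
  rw [tendsto_subtype_rng]
  simp only [h1]
  have := (M.starProjection.continuous.tendsto 0).comp (hS.adjoint_pow_tendsto x)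
  rwa [map_zero] at this

theorem IsDoublyCommutingShifts.restrictInvariant [CompleteSpace M]
    (hS : IsDoublyCommutingShifts S) (hM : ∀ k, ∀ x ∈ M, S k x ∈ M)
    (hdc : ∀ i j, i ≠ j → ∀ x ∈ M, M.starProjection (adjoint (S i) (S j x)) =
      S j (M.starProjection (adjoint (S i) x))) :
    IsDoublyCommutingShifts fun k => restrictInvariant (S k) (hM k) where
  isShift k := (hS.isShift k).restrictInvariant (hM k)
  comm i j := by
    ext x
    exact DFunLike.congr_fun (hS.comm i j) (x : H)
  doubly_comm i j hij := by
    ext x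
    rw [mul_apply_eq_comp, mul_apply_eq_comp, coe_restrictInvariant,
      coe_adjoint_restrictInvariant, coe_adjoint_restrictInvariant]
    exact hdc i j hij x x.2

theorem multiIndex_induction {p : (Fin n → ℕ) → Prop} (zero : p 0)
    (step : ∀ k γ, p γ → p (Pi.single k 1 + γ)) (β : Fin n → ℕ) : p β := by
  obtain ⟨m, hm⟩ : ∃ m, ∑ k, β k = m := ⟨_, rfl⟩
  induction m generalizing β with
  | zero =>
    have : β = 0 := funext fun k => Finset.sum_eq_zero_iff.1 hm k (Finset.mem_univ k)
    rwa [this]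
  | succ m ih =>
    obtain ⟨k, hk⟩ : ∃ k, β k ≠ 0 := by
      by_contra! h
      simp [h] at hm
    obtain ⟨γ, rfl⟩ := exists_eq_single_add hk
    refine step k γ (ih γ ?_)
    simp only [Pi.add_apply, Finset.sum_add_distrib, Finset.sum_pi_single', Finset.mem_univ,
      if_true] at hm
    omega

theorem coe_monomial_restrictInvariant [CompleteSpace M]
    (hS : IsDoublyCommutingShifts S) (hM : ∀ k, ∀ x ∈ M, S k x ∈ M)
    (hR : IsDoublyCommutingShifts fun k => restrictInvariant (S k) (hM k))
    (β : Fin n → ℕ) (x : M) : (hR.monomial β x : H) = hS.monomial β x := by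
  induction β using multiIndex_induction with
  | zero => rw [hR.monomial_zero, hS.monomial_zero]; rfl
  | step k γ ih =>
    rw [hR.monomial_single_add, hS.monomial_single_add, mul_apply_eq_comp, mul_apply_eq_comp,
      coe_restrictInvariant, ih]

/-- Beurling–Lax–Halmos: a doubly commuting invariant subspace is the range of a partially
isometric analytic operator. -/
theorem exists_analytic_mul_adjoint_eq_starProjection [TopologicalSpace.SeparableSpace H]
    [CompleteSpace M] (hS : IsDoublyCommutingShifts S) (hM : ∀ k, ∀ x ∈ M, S k x ∈ M)
    (hdc : ∀ i j, i ≠ j → ∀ x ∈ M, M.starProjection (adjoint (S i) (S j x)) =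
      S j (M.starProjection (adjoint (S i) x))) :
    ∃ W : H →L[ℂ] H, IsSAnalytic S W ∧ IsPartialIsometry W ∧
      W * adjoint W = M.starProjection := by
  have hR := hS.restrictInvariant hM hdc
  obtain ⟨κ, e, -⟩ := exists_hilbertBasis ℂ (wandering S)
  obtain ⟨ι, f, -⟩ := exists_hilbertBasis ℂ (wandering fun k => restrictInvariant (S k) (hM k))
  set bH := hS.hilbertBasis e with hbH
  set bM := hR.hilbertBasis f with hbM
  have hbM_coe : ∀ p, (bM p : H) = hS.monomial p.1 (f p.2 : M) := fun p => by
    rw [hbM, hR.hilbertBasis_apply, coe_monomial_restrictInvariant hS hM hR]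
  have hforth : Orthonormal ℂ fun p : (Fin n → ℕ) × ι => hS.monomial p.1 ((f p.2 : M) : H) := by
    simpa only [hbM_coe] using orthonormal_coe bM.orthonormal
  obtain ⟨g⟩ := hS.nonempty_embedding_wandering e (f := fun i => ((f i : M) : H)) hforth
  have hv : Orthonormal ℂ fun p : (Fin n → ℕ) × ι => bH (p.1, g p.2) :=
    bH.orthonormal.comp (fun p : (Fin n → ℕ) × ι => (p.1, g p.2)) fun p q h => by
      simp only [Prod.mk.injEq] at h
      exact Prod.ext h.1 (g.injective h.2)
  classical
  -- `J` sends `S^β f_i` to `S^β e_(g i)`, matching the two Wold bases; the required operator is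
  -- `J*` followed by the inclusion of `M`.
  set J : M →ₗᵢ[ℂ] H := hv.orthogonalFamily.linearIsometry.comp bM.repr.toLinearIsometry with hJ
  have hJb : ∀ p, J (bM p) = bH (p.1, g p.2) := fun p => by
    simp [hJ, HilbertBasis.repr_self]
  set A : M →L[ℂ] H := J.toContinuousLinearMap with hA
  have hAA : ∀ x, adjoint A (A x) = x := fun x => by
    refine ext_inner_right ℂ fun y => ?_
    rw [ContinuousLinearMap.adjoint_inner_left]
    exact J.inner_map_map x y
  have hA0 : ∀ β l, l ∉ Set.range g → adjoint A (bH (β, l)) = 0 := fun β l hl => by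
    apply bM.repr.injective
    ext p
    rw [bM.repr_apply_apply, map_zero, ContinuousLinearMap.adjoint_inner_right]
    change inner ℂ (J (bM p)) (bH (β, l)) = 0
    rw [hJb]
    refine bH.orthonormal.2 fun h => hl ⟨p.2, ?_⟩
    simp only [Prod.mk.injEq] at h
    exact h.2
  have hWW : (M.subtypeL ∘L adjoint A) * adjoint (M.subtypeL ∘L adjoint A) =
      M.starProjection := by
    rw [ContinuousLinearMap.adjoint_comp, ContinuousLinearMap.adjoint_adjoint,
      Submodule.adjoint_subtypeL]
    ext x
    change ((adjoint A (A (M.orthogonalProjectionOnto x)) : M) : H) = _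
    rw [hAA]
    rfl
  refine ⟨M.subtypeL ∘L adjoint A, fun k => ?_, ?_, hWW⟩
  -- Commutation is checked on the Wold basis: `S k` only raises the exponent and keeps `l`, and for
  -- `l` outside the range of `g` both sides vanish.
  · refine ContinuousLinearMap.ext_on
      (Submodule.dense_iff_topologicalClosure_eq_top.2 bH.dense_span) ?_
    rintro _ ⟨⟨β, l⟩, rfl⟩
    have hshift : S k (bH (β, l)) = bH (Pi.single k 1 + β, l) := by
      rw [hbH, hS.hilbertBasis_apply, hS.hilbertBasis_apply, hS.monomial_single_add,
        mul_apply_eq_comp]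
    change S k (adjoint A (bH (β, l)) : M) = ((adjoint A (S k (bH (β, l))) : M) : H)
    rw [hshift]
    by_cases hl : l ∈ Set.range g
    · obtain ⟨i, rfl⟩ := hl
      have hW : ∀ α, adjoint A (bH (α, g i)) = bM (α, i) := fun α => by
        rw [← hJb (α, i)]
        exact hAA _
      rw [hW, hW, hbM_coe, hbM_coe, hS.monomial_single_add, mul_apply_eq_comp]
    · rw [hA0 _ _ hl, hA0 _ _ hl]
      simp
  · rw [isPartialIsometry_iff, hWW]
    ext x
    exact Submodule.starProjection_eq_self_iff.2 (adjoint A x).2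

end InvariantSubspace

/-! ### The main theorem. -/

theorem mainTheorem10 {H : Type*} [NormedAddCommGroup H] [InnerProductSpace ℂ H]
    [CompleteSpace H] [TopologicalSpace.SeparableSpace H] {n : ℕ}
    (S : Fin n → H →L[ℂ] H) (hS : IsDoublyCommutingShifts S)
    (T : H →L[ℂ] H) (hT : IsSToeplitz S T) :
    (IsPartialIsometry T ↔
      ∃ W₁ W₂ : H →L[ℂ] H, IsAnalyticPair S W₁ W₂ ∧ T = W₁ * adjoint W₂ ∧
        (∀ k, kerCompression S W₁ W₂ k = 0) ∧ (∀ k, wanderingCompression S W₁ W₂ k = 0)) ∧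
    (∀ W₁ W₂ : H →L[ℂ] H, IsAnalyticPair S W₁ W₂ → T = W₁ * adjoint W₂ →
      (∀ k, kerCompression S W₁ W₂ k = 0) ∧ (∀ k, wanderingCompression S W₁ W₂ k = 0)) ∧
    (∀ W₁ W₂ : H →L[ℂ] H, IsAnalyticPair S W₁ W₂ → ∀ k,
      (kerCompression S W₁ W₂ k = 0 ↔ wanderingCompression S W₁ W₂ k = 0)) := by
  have hiff : ∀ W₁ W₂ : H →L[ℂ] H, IsAnalyticPair S W₁ W₂ → ∀ k,
      (kerCompression S W₁ W₂ k = 0 ↔ wanderingCompression S W₁ W₂ k = 0) :=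
    fun W₁ W₂ h k => hS.kerCompression_eq_zero_iff h.analytic_left h.analytic_right k
  have hab : ∀ W₁ W₂ : H →L[ℂ] H, IsAnalyticPair S W₁ W₂ → T = W₁ * adjoint W₂ →
      (∀ k, kerCompression S W₁ W₂ k = 0) ∧ (∀ k, wanderingCompression S W₁ W₂ k = 0) := by
    intro W₁ W₂ h hTW
    have ha : ∀ k, kerCompression S W₁ W₂ k = 0 := fun k => by
      rw [hS.kerCompression_eq h.analytic_left h.analytic_right, ← hTW, hT k, sub_self]
    exact ⟨ha, fun k => (hiff W₁ W₂ h k).1 (ha k)⟩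
  refine ⟨⟨fun hpi => ?_, ?_⟩, hab, hiff⟩
  · suffices h : ∃ W₁ W₂ : H →L[ℂ] H, IsAnalyticPair S W₁ W₂ ∧ T = W₁ * adjoint W₂ by
      obtain ⟨W₁, W₂, h, hTW⟩ := h
      exact ⟨W₁, W₂, h, hTW, hab W₁ W₂ h hTW⟩
    have hT' := isSToeplitz_adjoint hT
    have hpi' := isPartialIsometry_iff.1 hpi
    have hiso := fun k => (hS.isShift k).isometry
    have hP : adjoint T * T = (opKer T)ᗮ.starProjection :=
      isPartialIsometry_iff_adjoint_mul_self.1 hpi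
    have hmem : ∀ x ∈ (opKer T)ᗮ, (adjoint T * T) x = x := fun x hx => by
      rw [hP]; exact Submodule.starProjection_eq_self_iff.2 hx
    have hinv : ∀ k, adjoint T * S k * T = S k * (adjoint T * T) := fun k =>
      hpi.initial_invariant (hiso k) (hT' k)
    have hM : ∀ k, ∀ x ∈ (opKer T)ᗮ, S k x ∈ (opKer T)ᗮ := fun k x hx => by
      rw [← Submodule.starProjection_eq_self_iff, ← hP]
      have h1 : adjoint T * T * (S k * (adjoint T * T)) = S k * (adjoint T * T) := by
        rw [← hinv]
        simp only [← mul_assoc]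
        rw [show adjoint T * T * adjoint T = adjoint T by
          simpa using isPartialIsometry_iff.1 (isPartialIsometry_adjoint hpi)]
      have h2 := DFunLike.congr_fun h1 x
      rw [mul_apply_eq_comp (adjoint T * T), mul_apply_eq_comp (S k), hmem x hx] at h2
      exact h2
    have hdc : ∀ i j, i ≠ j → ∀ x ∈ (opKer T)ᗮ,
        (opKer T)ᗮ.starProjection (adjoint (S i) (S j x)) =
          S j ((opKer T)ᗮ.starProjection (adjoint (S i) x)) := fun i j hij x hx => by
      -- Used for `T*`, whose final space is the initial space of `T`.
      have h1 := final_doubly_commuting (isPartialIsometry_adjoint hpi) (hiso j) (hiso i)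
        (hT' i) (hT' j) (by simpa using hT j) (hS.doubly_comm i j hij)
      rw [ContinuousLinearMap.adjoint_adjoint] at h1
      have h2 := DFunLike.congr_fun h1 x
      rw [mul_apply_eq_comp, hmem x hx, hP] at h2
      exact h2
    obtain ⟨W, hW, hWpi, hWW⟩ := exists_analytic_mul_adjoint_eq_starProjection hS hM hdc
    rw [← hP] at hWW
    have hTP : T * (W * adjoint W) = T := by rw [hWW, ← mul_assoc, hpi']
    have hWWW := isPartialIsometry_iff.1 hWpi
    have hstar : adjoint (T * W) * (T * W) = adjoint W * W := by
      rw [adjoint_mul]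
      calc adjoint W * adjoint T * (T * W) = adjoint W * (adjoint T * T) * W := by
            simp only [mul_assoc]
        _ = adjoint W * (W * adjoint W * W) := by rw [← hWW]; simp only [mul_assoc]
        _ = adjoint W * W := by rw [hWWW]
    -- `T` is isometric on the range of `W`, so `T W` has the same initial space as `W`; there `T`
    -- also commutes with each `S k`, so `T W` is analytic.
    refine ⟨T * W, W, ⟨?_, hWpi, fun k => ?_, hW,
      initialSpace_eq_of_adjoint_mul_self_eq hstar⟩, ?_⟩
    · rw [isPartialIsometry_iff, mul_assoc, hstar, mul_assoc, ← mul_assoc W, hWWW]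
    · have h1 := hpi.intertwine (hiso k) (hT k)
      calc S k * (T * W) = T * S k * (adjoint T * T) * W := by rw [h1, mul_assoc]
        _ = T * S k * (W * adjoint W * W) := by rw [← hWW]; simp only [mul_assoc]
        _ = T * W * S k := by rw [hWWW, mul_assoc, hW, mul_assoc]
    · rw [mul_assoc, hTP]
  · rintro ⟨W₁, W₂, h, rfl, -⟩
    exact h.partialIsometry_left.mul_adjoint h.partialIsometry_right h.initialSpace_eq
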